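/- Let $X \in M_m \otimes M_n$ be a density matrix ($X \ge 0$, $\operatorname{Tr} X = 1$), and let $X_1 = \operatorname{Tr}_2 X \in M_m$ be its reduced density matrix. Write $\|A\|_p = (\operatorname{Tr}|A|^p)^{1/p}$ for the Schatten norm and, for $p > 1$ and $p' = p/(p-1)$, let $$\|X\|_{(1,p)} = \inf\bigl\{ \|A\|_{2p'}\,\|C\|_{2p'}\,\|Z\|_p \;:\; X = (A\otimes I_n)\,Z\,(C\otimes I_n),\ A, C\in M_m,\ Z\in M_m\otimes M_n\bigr\}$$ be the norm of $X$ in $L_1(M_m;L_p(M_n))$. For each $p\in(1,2]$ let $B(p)\in M_m$ be a density matrix (positive semidefinite, of trace one) with $\ker B(p)\subseteq\ker X_1$ that minimizes $\|X\|_{(1,p)}$, i.e. $$\bigl\| X^{1/2}\,(B(p)^{\frac1p-1}\otimes I_n)\,X^{1/2}\bigr\|_p = \|X\|_{(1,p)},$$ where the negative power $B(p)^{\frac1p-1}$ is taken on $(\ker B(p))^\perp$ and is $0$ on $\ker B(p)$. Then $$\lim_{p\to 1+} B(p) = X_1 .$$ -/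

import Mathlib

open Filter Topology
open scoped Matrix Kronecker ComplexOrder

noncomputable section

namespace MixedNorm

/-- The real power `A ^ s = ∑ₖ λₖ ^ s |φₖ⟩⟨φₖ|` of a positive semidefinite matrix with spectral
decomposition `A = ∑ₖ λₖ |φₖ⟩⟨φₖ|`. For `s ≠ 0` it vanishes on `ker A` (as `0 ^ s = 0`), so a
negative power is the power of the inverse on `(ker A)ᗮ`. -/
def matPow {ι : Type*} [Fintype ι] [DecidableEq ι] (A : Matrix ι ι ℂ) (s : ℝ) : Matrix ι ι ℂ :=
  cfc (fun t : ℝ => t ^ s) A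

/-- The Schatten norm `‖A‖_p = (Tr |A| ^ p) ^ (1 / p)`, where `|A| ^ p = (Aᴴ A) ^ (p / 2)`. -/
def schattenNorm {ι : Type*} [Fintype ι] [DecidableEq ι] (p : ℝ) (A : Matrix ι ι ℂ) : ℝ :=
  ((matPow (Aᴴ * A) (p / 2)).trace.re) ^ (1 / p)

/-- The embedding `A ↦ A ⊗ Iₙ` of `M_m` into `M_m ⊗ M_n`. -/
def ampl {m : ℕ} (n : ℕ) (A : Matrix (Fin m) (Fin m) ℂ) :
    Matrix (Fin m × Fin n) (Fin m × Fin n) ℂ :=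
  A ⊗ₖ (1 : Matrix (Fin n) (Fin n) ℂ)

/-- The partial trace over the second factor, `Tr₂ : M_m ⊗ M_n → M_m`. -/
def partialTrace₂ {m n : ℕ} (X : Matrix (Fin m × Fin n) (Fin m × Fin n) ℂ) :
    Matrix (Fin m) (Fin m) ℂ :=
  Matrix.of fun i j => ∑ k : Fin n, X (i, k) (j, k)

/-- Density matrices: positive semidefinite matrices of trace one. -/
def IsDensity {ι : Type*} [Fintype ι] (A : Matrix ι ι ℂ) : Prop :=
  A.PosSemidef ∧ A.trace = 1

/-- The norm of `L₁(M_m; L_p(M_n))` for `1 < p < ∞`: the infimum of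
`‖A‖_{2p'} ‖B‖_{2p'} ‖Z‖_p` over all factorizations `Y = (A ⊗ I) Z (B ⊗ I)`, where `A, B ∈ M_m`,
`Z ∈ M_m ⊗ M_n` and `p' = p / (p - 1)` is the conjugate exponent. -/
def norm1p {m n : ℕ} (p : ℝ) (Y : Matrix (Fin m × Fin n) (Fin m × Fin n) ℂ) : ℝ :=
  sInf {c : ℝ | ∃ (A B : Matrix (Fin m) (Fin m) ℂ)
      (Z : Matrix (Fin m × Fin n) (Fin m × Fin n) ℂ),
    Y = ampl n A * Z * ampl n B ∧
    c = schattenNorm (2 * (p / (p - 1))) A * schattenNorm (2 * (p / (p - 1))) B *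
      schattenNorm p Z}

/-- `v(p, B) = X ^ (1/2) (B ^ (1/p - 1) ⊗ I) X ^ (1/2)`. -/
def vMat {m n : ℕ} (X : Matrix (Fin m × Fin n) (Fin m × Fin n) ℂ) (p : ℝ)
    (B : Matrix (Fin m) (Fin m) ℂ) : Matrix (Fin m × Fin n) (Fin m × Fin n) ℂ :=
  matPow X (1 / 2) * ampl n (matPow B (1 / p - 1)) * matPow X (1 / 2)

/-- The density matrices `B` with `ker B ⊆ ker (Tr₂ X)`. These are the density matrices for which
the negative power `B ^ (1/p - 1)` in `v(p, B)` is meaningful for `p > 1`. -/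
def admissible {m n : ℕ} (X : Matrix (Fin m × Fin n) (Fin m × Fin n) ℂ) :
    Set (Matrix (Fin m) (Fin m) ℂ) :=
  {B | IsDensity B ∧
    LinearMap.ker B.mulVecLin ≤ LinearMap.ker (partialTrace₂ X).mulVecLin}

/-- `B` is a density matrix that minimizes `‖X‖_{(1,p)}`, i.e. `‖v(p, B)‖_p = ‖X‖_{(1,p)}`. -/
def IsMinimizer {m n : ℕ} (X : Matrix (Fin m × Fin n) (Fin m × Fin n) ℂ) (p : ℝ)
    (B : Matrix (Fin m) (Fin m) ℂ) : Prop :=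
  B ∈ admissible X ∧ schattenNorm p (vMat X p B) = norm1p p X

end MixedNorm

end

/-!
Set `v(p) = v(p, B(p))` and let `Y(p)` be the marginal of `X ^ (2 - 1/p)`, which tends to `X₁`.
Young's trace inequality for the product of `v(p)` and `X ^ (1 - 1/p)` bounds
`Tr (Y(p) B(p) ^ (1/p - 1))` from above by `Tr v(p) ^ p / p + 1 - 1/p`. A Gibbs inequality bounds
it from below, with a remainder: relative entropy dominates the squared Hellinger distance
`D(p) = Tr (√Y(p) - √B(p))²`. Together, writing `S` for the von Neumann entropy,
`D(p) ≤ (Tr v(p) ^ p - 1) / (p - 1) + S(X) - S(X₁) + o(1)`.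
Since `B(p)` minimizes, it may be replaced by `X₁` in the difference quotient, which then has
upper limit at most `S(X₁) - S(X)`. Hence `D(p) → 0`, and `B(p)` has the same limit as `Y(p)`.
-/

namespace MixedNorm

section ScalarInequalities

lemma one_add_mul_log_le_rpow {x : ℝ} (hx : 0 < x) (s : ℝ) : 1 + s * Real.log x ≤ x ^ s := by
  rw [Real.rpow_def_of_pos hx, add_comm, mul_comm]
  exact Real.add_one_le_exp _

lemma sq_sqrt_sub_sqrt_le_of_pos {x y : ℝ} (hx : 0 < x) (hy : 0 < y) :
    (√x - √y) ^ 2 ≤ -x * Real.log y - Real.negMulLog x - x + y := by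
  have hlog : Real.log (√y / √x) ≤ √y / √x - 1 := Real.log_le_sub_one_of_pos (by positivity)
  rw [Real.log_div (by positivity) (by positivity), Real.log_sqrt hy.le, Real.log_sqrt hx.le]
    at hlog
  have hcross : x * (√y / √x) = √x * √y := by
    nth_rw 1 [← Real.mul_self_sqrt hx.le]
    field_simp
  have hmul : x * (Real.log y / 2 - Real.log x / 2) ≤ √x * √y - x := by
    simpa only [mul_sub_one, hcross] using mul_le_mul_of_nonneg_left hlog hx.le
  rw [Real.negMulLog, sub_sq, Real.sq_sqrt hx.le, Real.sq_sqrt hy.le]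
  linarith

lemma add_mul_le_mul_rpow_neg {x y ε : ℝ} (hx : 0 ≤ x) (hy : 0 ≤ y) (hxy : y = 0 → x = 0)
    (hε : 0 ≤ ε) :
    x + ε * (Real.negMulLog x + x - y + (√x - √y) ^ 2) ≤ x * y ^ (-ε) := by
  rcases hx.eq_or_lt with rfl | hx
  · simp [Real.sq_sqrt hy]
  have hy : 0 < y := hy.lt_of_ne' fun h => hx.ne' (hxy h)
  have hrpow := mul_le_mul_of_nonneg_left (one_add_mul_log_le_rpow hy (-ε)) hx.le
  have hsqrt := mul_le_mul_of_nonneg_left (sq_sqrt_sub_sqrt_le_of_pos hx hy) hε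
  linarith

lemma sub_mul_negMulLog_le_rpow_one_add {x ε : ℝ} (hx : 0 ≤ x) (hε : 0 ≤ ε) :
    x - ε * Real.negMulLog x ≤ x ^ (1 + ε) := by
  rcases hx.eq_or_lt with rfl | hx
  · simp [Real.zero_rpow (by linarith : 1 + ε ≠ 0)]
  have hrpow := mul_le_mul_of_nonneg_left (one_add_mul_log_le_rpow hx ε) hx.le
  rw [Real.rpow_add hx, Real.rpow_one, Real.negMulLog]
  linarith

lemma rpow_sub_self_div_le_rpow_sub_self_div {x p q : ℝ} (hx : 0 ≤ x) (hp : 1 < p) (hpq : p ≤ q) :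
    (x ^ p - x) / (p - 1) ≤ (x ^ q - x) / (q - 1) := by
  rcases hx.eq_or_lt with rfl | hx
  · simp [Real.zero_rpow (by linarith : p ≠ 0), Real.zero_rpow (by linarith : q ≠ 0)]
  simpa using (convexOn_rpow_left hx).secant_mono (a := 1) trivial trivial trivial hp.ne'
    (hp.trans_le hpq).ne' hpq

lemma hasDerivAt_const_rpow_one {x : ℝ} (hx : 0 ≤ x) :
    HasDerivAt (fun s : ℝ => x ^ s) (-Real.negMulLog x) 1 := by
  rcases hx.eq_or_lt with rfl | hx
  · have hzero : (fun s : ℝ => (0 : ℝ) ^ s) =ᶠ[𝓝 1] fun _ => 0 := by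
      filter_upwards [isOpen_ne.mem_nhds one_ne_zero] with s hs using Real.zero_rpow hs
    simpa using (hasDerivAt_const (1 : ℝ) (0 : ℝ)).congr_of_eventuallyEq hzero
  · simpa [Real.negMulLog] using (Real.hasStrictDerivAt_const_rpow hx 1).hasDerivAt

end ScalarInequalities

section Limits

lemma tendsto_slope_nhdsGT_of_hasDerivAt {f : ℝ → ℝ} {f' a : ℝ} (h : HasDerivAt f f' a) :
    Tendsto (fun t => (f t - f a) / (t - a)) (𝓝[>] a) (𝓝 f') :=
  ((hasDerivWithinAt_iff_tendsto_slope' Set.self_notMem_Ioi).1 h.hasDerivWithinAt).congr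
    (slope_def_field f a)

lemma tendsto_one_div_nhdsGT_one : Tendsto (fun p : ℝ => 1 / p) (𝓝[>] 1) (𝓝 1) := by
  simpa using (tendsto_inv₀ (one_ne_zero (α := ℝ))).mono_left nhdsWithin_le_nhds

lemma one_sub_one_div_pos {p : ℝ} (hp : 1 < p) : 0 < 1 - 1 / p :=
  sub_pos.2 ((div_lt_one (one_pos.trans hp)).2 hp)

variable {ι α : Type*} [Fintype ι] {l : Filter α} {M : α → Matrix ι ι ℂ}

lemma tendsto_trace_re {A : Matrix ι ι ℂ} (h : Tendsto M l (𝓝 A)) :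
    Tendsto (fun a => (M a).trace.re) l (𝓝 A.trace.re) :=
  ((Complex.continuous_re.comp continuous_id.matrix_trace).tendsto A).comp h

lemma trace_conjTranspose_mul_self_re (A : Matrix ι ι ℂ) :
    (Aᴴ * A).trace.re = ∑ j, ∑ i, ‖A i j‖ ^ 2 := by
  simp only [Matrix.trace, Matrix.diag_apply, Matrix.mul_apply, Matrix.conjTranspose_apply,
    RCLike.star_def, Complex.conj_mul', Complex.re_sum, ← Complex.ofReal_pow, Complex.ofReal_re]

lemma norm_apply_le_sqrt_trace_conjTranspose_mul_self (A : Matrix ι ι ℂ) (i j : ι) :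
    ‖A i j‖ ≤ √(Aᴴ * A).trace.re := by
  refine Real.le_sqrt_of_sq_le ?_
  rw [trace_conjTranspose_mul_self_re]
  calc ‖A i j‖ ^ 2 ≤ ∑ i, ‖A i j‖ ^ 2 :=
        Finset.single_le_sum (f := fun i => ‖A i j‖ ^ 2) (fun _ _ => sq_nonneg _)
          (Finset.mem_univ i)
    _ ≤ ∑ j, ∑ i, ‖A i j‖ ^ 2 :=
        Finset.single_le_sum (f := fun j => ∑ i, ‖A i j‖ ^ 2)
          (fun _ _ => Finset.sum_nonneg fun _ _ => sq_nonneg _) (Finset.mem_univ j)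

lemma tendsto_zero_of_tendsto_trace_conjTranspose_mul_self
    (h : Tendsto (fun a => ((M a)ᴴ * M a).trace.re) l (𝓝 0)) : Tendsto M l (𝓝 0) :=
  tendsto_pi_nhds.2 fun i => tendsto_pi_nhds.2 fun j => squeeze_zero_norm
    (fun a => norm_apply_le_sqrt_trace_conjTranspose_mul_self (M a) i j) (by simpa using h.sqrt)

end Limits

section SpectralCalculus

variable {ι : Type*} [Fintype ι] [DecidableEq ι] {A B : Matrix ι ι ℂ}

lemma continuousOn_spectrum (f : ℝ → ℝ) (A : Matrix ι ι ℂ) : ContinuousOn f (spectrum ℝ A) :=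
  A.finite_real_spectrum.continuousOn f

lemma nonneg_of_mem_spectrum (hA : A.PosSemidef) {x : ℝ} (hx : x ∈ spectrum ℝ A) : 0 ≤ x := by
  obtain ⟨i, rfl⟩ := hA.1.spectrum_real_eq_range_eigenvalues ▸ hx
  exact hA.eigenvalues_nonneg i

lemma isHermitian_cfc (f : ℝ → ℝ) (A : Matrix ι ι ℂ) : (cfc f A).IsHermitian :=
  cfc_predicate f A

open scoped MatrixOrder in
lemma posSemidef_cfc {f : ℝ → ℝ} (hf : ∀ x ∈ spectrum ℝ A, 0 ≤ f x) : (cfc f A).PosSemidef :=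
  Matrix.nonneg_iff_posSemidef.1 (cfc_nonneg hf)

lemma cfc_id_of_isHermitian (hA : A.IsHermitian) : cfc (fun t : ℝ => t) A = A :=
  cfc_id' ℝ A hA

lemma cfc_mul_cfc (f g : ℝ → ℝ) (A : Matrix ι ι ℂ) :
    cfc f A * cfc g A = cfc (fun t => f t * g t) A :=
  (cfc_mul f g A (continuousOn_spectrum f A) (continuousOn_spectrum g A)).symm

lemma trace_cfc (hA : A.IsHermitian) (f : ℝ → ℝ) :
    (cfc f A).trace = ∑ i, (f (hA.eigenvalues i) : ℂ) := by
  rw [hA.cfc_eq, Matrix.IsHermitian.cfc, Unitary.conjStarAlgAut_apply, Matrix.trace_mul_cycle]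
  simp [Matrix.trace]

lemma trace_cfc_re (hA : A.IsHermitian) (f : ℝ → ℝ) :
    (cfc f A).trace.re = ∑ i, f (hA.eigenvalues i) := by
  rw [trace_cfc hA, ← Complex.ofReal_sum, Complex.ofReal_re]

lemma trace_re_eq_sum_eigenvalues (hA : A.IsHermitian) : A.trace.re = ∑ i, hA.eigenvalues i := by
  rw [← trace_cfc_re hA fun t => t, cfc_id_of_isHermitian hA]

lemma trace_cfc_eq_of_charpoly_eq (hA : A.IsHermitian) (hB : B.IsHermitian)
    (h : A.charpoly = B.charpoly) (f : ℝ → ℝ) : (cfc f A).trace = (cfc f B).trace := by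
  rw [trace_cfc hA, trace_cfc hB, (hA.eigenvalues_eq_eigenvalues_iff hB).2 h]

lemma tendsto_cfc_of_tendsto_on_spectrum {α : Type*} {l : Filter α} {F : α → ℝ → ℝ} {f : ℝ → ℝ}
    (h : ∀ x ∈ spectrum ℝ A, Tendsto (fun a => F a x) l (𝓝 (f x))) :
    Tendsto (fun a => cfc (F a) A) l (𝓝 (cfc f A)) :=
  tendsto_cfc_fun
    (fun _ hu => A.finite_real_spectrum.eventually_all.2 fun x hx =>
      (Uniform.tendsto_nhds_right.1 (h x hx)).eventually hu)
    (Eventually.of_forall fun a => continuousOn_spectrum (F a) A)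

open scoped Matrix.Norms.L2Operator in
lemma continuousOn_cfc_isHermitian {f : ℝ → ℝ} (hf : Continuous f) :
    ContinuousOn (cfc f) {M : Matrix ι ι ℂ | M.IsHermitian} :=
  continuousOn_id.cfc_of_mem_nhdsSet f (s := Set.univ) univ_mem (fun _ hM => hM) hf.continuousOn

lemma tendsto_cfc_of_tendsto {α : Type*} {l : Filter α} {M : α → Matrix ι ι ℂ} {f : ℝ → ℝ}
    (hf : Continuous f) (hM : ∀ᶠ a in l, (M a).IsHermitian) (hA : A.IsHermitian)
    (h : Tendsto M l (𝓝 A)) : Tendsto (fun a => cfc f (M a)) l (𝓝 (cfc f A)) :=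
  (continuousOn_cfc_isHermitian hf A hA).tendsto.comp (tendsto_nhdsWithin_iff.2 ⟨h, hM⟩)

/-- The orthogonal projection onto the range of a Hermitian matrix `A`, that is onto `(ker A)ᗮ`. -/
noncomputable def supportProj (A : Matrix ι ι ℂ) : Matrix ι ι ℂ :=
  cfc (fun t : ℝ => if t = 0 then 0 else 1) A

lemma mul_supportProj (hA : A.IsHermitian) : A * supportProj A = A := by
  have hmul := cfc_mul_cfc (fun t => t) (fun t => if t = 0 then 0 else 1) A
  have hid : (fun t : ℝ => t * if t = 0 then 0 else 1) = fun t => t := by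
    funext t
    split_ifs with ht <;> simp [ht]
  rwa [hid, cfc_id_of_isHermitian hA] at hmul

lemma mul_supportProj_of_ker_le (hB : B.IsHermitian)
    (h : LinearMap.ker B.mulVecLin ≤ LinearMap.ker A.mulVecLin) : A * supportProj B = A := by
  have hzero : B * (1 - supportProj B) = 0 := by rw [mul_sub, mul_one, mul_supportProj hB, sub_self]
  suffices A * (1 - supportProj B) = 0 by
    rwa [mul_sub, mul_one, sub_eq_zero, eq_comm] at this
  refine Matrix.ext_of_mulVec_single fun j => ?_
  have hker : (1 - supportProj B) *ᵥ Pi.single j 1 ∈ LinearMap.ker B.mulVecLin := by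
    rw [LinearMap.mem_ker, Matrix.mulVecLin_apply, Matrix.mulVec_mulVec, hzero, Matrix.zero_mulVec]
  rw [Matrix.zero_mulVec, ← Matrix.mulVec_mulVec]
  exact h hker

end SpectralCalculus

section MatrixPowers

variable {ι : Type*} [Fintype ι] [DecidableEq ι] {A : Matrix ι ι ℂ}

lemma matPow_one (hA : A.IsHermitian) : matPow A 1 = A := by
  simp only [matPow, Real.rpow_one, cfc_id_of_isHermitian hA]

lemma isHermitian_matPow (A : Matrix ι ι ℂ) (s : ℝ) : (matPow A s).IsHermitian :=
  isHermitian_cfc _ A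

lemma posSemidef_matPow (hA : A.PosSemidef) (s : ℝ) : (matPow A s).PosSemidef :=
  posSemidef_cfc fun _ hx => Real.rpow_nonneg (nonneg_of_mem_spectrum hA hx) s

lemma trace_matPow_re_nonneg (hA : A.PosSemidef) (s : ℝ) : 0 ≤ (matPow A s).trace.re :=
  (Complex.le_def.1 (posSemidef_matPow hA s).trace_nonneg).1

lemma matPow_mul_matPow (hA : A.PosSemidef) {s t : ℝ} (h : s + t ≠ 0) :
    matPow A s * matPow A t = matPow A (s + t) := by
  simp only [matPow, cfc_mul_cfc]
  exact cfc_congr fun x hx => (Real.rpow_add' (nonneg_of_mem_spectrum hA hx) h).symm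

lemma matPow_half_mul_self (hA : A.PosSemidef) : matPow A (1 / 2) * matPow A (1 / 2) = A := by
  rw [matPow_mul_matPow hA (by norm_num), add_halves, matPow_one hA.1]

lemma matPow_mul_matPow_neg (hA : A.PosSemidef) {s : ℝ} (hs : s ≠ 0) :
    matPow A s * matPow A (-s) = supportProj A := by
  simp only [matPow, supportProj, cfc_mul_cfc]
  refine cfc_congr fun x hx => ?_
  rcases (nonneg_of_mem_spectrum hA hx).eq_or_lt with rfl | hx
  · simp [Real.zero_rpow hs]
  · simp [← Real.rpow_add hx, hx.ne']

lemma matPow_matPow (hA : A.PosSemidef) (s t : ℝ) :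
    matPow (matPow A s) t = matPow A (s * t) := by
  have hcomp : matPow (matPow A s) t = cfc (fun x : ℝ => (x ^ s) ^ t) A :=
    (cfc_comp' (fun x : ℝ => x ^ t) (fun x : ℝ => x ^ s) A
      ((A.finite_real_spectrum.image _).continuousOn _) (continuousOn_spectrum _ A) hA.1).symm
  rw [hcomp]
  exact cfc_congr fun x hx => (Real.rpow_mul (nonneg_of_mem_spectrum hA hx) s t).symm

lemma tendsto_matPow (A : Matrix ι ι ℂ) {s : ℝ} (hs : s ≠ 0) :
    Tendsto (matPow A) (𝓝 s) (𝓝 (matPow A s)) :=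
  tendsto_cfc_of_tendsto_on_spectrum fun _ _ => Real.continuousAt_const_rpow' hs

lemma tendsto_matPow_supportProj (A : Matrix ι ι ℂ) :
    Tendsto (matPow A) (𝓝[≠] 0) (𝓝 (supportProj A)) := by
  refine tendsto_cfc_of_tendsto_on_spectrum fun x _ => ?_
  split_ifs with hx
  · refine tendsto_const_nhds.congr' ?_
    filter_upwards [self_mem_nhdsWithin] with s hs
    rw [hx, Real.zero_rpow hs]
  · simpa using (Real.continuousAt_const_rpow hx (b := 0)).tendsto.mono_left nhdsWithin_le_nhds

/-- The von Neumann entropy `-Tr (A log A)` of a positive semidefinite matrix, with the convention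
`0 log 0 = 0`. -/
noncomputable def entropy (A : Matrix ι ι ℂ) : ℝ :=
  (cfc Real.negMulLog A).trace.re

lemma trace_sub_mul_entropy_le_trace_matPow (hA : A.PosSemidef) {ε : ℝ} (hε : 0 ≤ ε) :
    A.trace.re - ε * entropy A ≤ (matPow A (1 + ε)).trace.re := by
  rw [matPow, entropy, trace_cfc_re hA.1, trace_cfc_re hA.1, trace_re_eq_sum_eigenvalues hA.1,
    Finset.mul_sum, ← Finset.sum_sub_distrib]
  exact Finset.sum_le_sum fun i _ =>
    sub_mul_negMulLog_le_rpow_one_add (hA.eigenvalues_nonneg i) hε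

lemma trace_matPow_sub_trace_div_le (hA : A.PosSemidef) {p q : ℝ} (hp : 1 < p) (hpq : p ≤ q) :
    ((matPow A p).trace.re - A.trace.re) / (p - 1) ≤
      ((matPow A q).trace.re - A.trace.re) / (q - 1) := by
  simp only [matPow, trace_cfc_re hA.1, trace_re_eq_sum_eigenvalues hA.1,
    ← Finset.sum_sub_distrib, Finset.sum_div]
  exact Finset.sum_le_sum fun i _ =>
    rpow_sub_self_div_le_rpow_sub_self_div (hA.eigenvalues_nonneg i) hp hpq

lemma hasDerivAt_trace_matPow_one (hA : A.PosSemidef) :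
    HasDerivAt (fun s => (matPow A s).trace.re) (-entropy A) 1 := by
  simp only [matPow, entropy, trace_cfc_re hA.1, ← Finset.sum_neg_distrib]
  exact HasDerivAt.fun_sum fun i _ => hasDerivAt_const_rpow_one (hA.eigenvalues_nonneg i)

lemma hasDerivAt_trace_matPow_one_div_one (hA : A.PosSemidef) :
    HasDerivAt (fun p : ℝ => (matPow A (1 / p)).trace.re) (entropy A) 1 := by
  have hinv : HasDerivAt (fun p : ℝ => 1 / p) (-1) 1 := by
    simpa using hasDerivAt_inv (one_ne_zero (α := ℝ))
  have hpow : HasDerivAt (fun s => (matPow A s).trace.re) (-entropy A) (1 / 1) := by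
    rw [div_one]
    exact hasDerivAt_trace_matPow_one hA
  simpa [Function.comp_def] using hpow.comp 1 hinv

lemma tendsto_entropy {α : Type*} {l : Filter α} {M : α → Matrix ι ι ℂ}
    (hM : ∀ᶠ a in l, (M a).IsHermitian) (hA : A.IsHermitian) (h : Tendsto M l (𝓝 A)) :
    Tendsto (fun a => entropy (M a)) l (𝓝 (entropy A)) :=
  tendsto_trace_re (tendsto_cfc_of_tendsto Real.continuous_negMulLog hM hA h)

end MatrixPowers

section JointTrace

variable {ι : Type*} [Fintype ι] [DecidableEq ι] {A B : Matrix ι ι ℂ}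

/-- The squared overlap `|⟨uᵢ, vⱼ⟩|²` of the eigenvectors `uᵢ` of `A` and `vⱼ` of `B`. -/
noncomputable def eigenOverlap (hA : A.IsHermitian) (hB : B.IsHermitian) (i j : ι) : ℝ :=
  Complex.normSq ((hA.eigenvectorUnitary.1ᴴ * hB.eigenvectorUnitary.1) i j)

/-- The monotone linear functional on functions of two variables that extends
`f ⊗ g ↦ Tr (f(A) g(B))`: it integrates `F` over the pairs of eigenvalues of `A` and `B`, weighted
by the squared overlaps of the eigenvectors. It lifts scalar inequalities in two variables to trace
inequalities for noncommuting matrices. -/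
noncomputable def jointTrace (hA : A.IsHermitian) (hB : B.IsHermitian) (F : ℝ → ℝ → ℝ) : ℝ :=
  ∑ i, ∑ j, eigenOverlap hA hB i j * F (hA.eigenvalues i) (hB.eigenvalues j)

lemma eigenOverlap_nonneg (hA : A.IsHermitian) (hB : B.IsHermitian) (i j : ι) :
    0 ≤ eigenOverlap hA hB i j :=
  Complex.normSq_nonneg _

lemma jointTrace_add (hA : A.IsHermitian) (hB : B.IsHermitian) (F G : ℝ → ℝ → ℝ) :
    jointTrace hA hB (fun x y => F x y + G x y) = jointTrace hA hB F + jointTrace hA hB G := by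
  simp only [jointTrace, mul_add, Finset.sum_add_distrib]

lemma jointTrace_const_mul (hA : A.IsHermitian) (hB : B.IsHermitian) (c : ℝ) (F : ℝ → ℝ → ℝ) :
    jointTrace hA hB (fun x y => c * F x y) = c * jointTrace hA hB F := by
  simp only [jointTrace, Finset.mul_sum, mul_left_comm c]

lemma jointTrace_sub (hA : A.IsHermitian) (hB : B.IsHermitian) (F G : ℝ → ℝ → ℝ) :
    jointTrace hA hB (fun x y => F x y - G x y) = jointTrace hA hB F - jointTrace hA hB G := by
  simp only [jointTrace, mul_sub, Finset.sum_sub_distrib]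

lemma cfc_eq_mul_diagonal_mul (hA : A.IsHermitian) (f : ℝ → ℝ) :
    cfc f A = hA.eigenvectorUnitary.1 * Matrix.diagonal (fun i => (f (hA.eigenvalues i) : ℂ)) *
      hA.eigenvectorUnitary.1ᴴ := by
  rw [hA.cfc_eq, Matrix.IsHermitian.cfc, Unitary.conjStarAlgAut_apply]
  rfl

lemma trace_diagonal_mul_mul_diagonal_mul_conjTranspose_re (a b : ι → ℝ) (W : Matrix ι ι ℂ) :
    (Matrix.diagonal (fun i => (a i : ℂ)) * W *
      (Matrix.diagonal (fun j => (b j : ℂ)) * Wᴴ)).trace.re =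
        ∑ i, ∑ j, Complex.normSq (W i j) * (a i * b j) := by
  rw [Matrix.trace, Complex.re_sum]
  refine Finset.sum_congr rfl fun i _ => ?_
  rw [Matrix.diag_apply, Matrix.mul_apply, Complex.re_sum]
  refine Finset.sum_congr rfl fun j _ => ?_
  simp only [Matrix.diagonal_mul, Matrix.conjTranspose_apply, Complex.normSq_apply,
    RCLike.star_def, Complex.mul_re, Complex.mul_im, Complex.ofReal_re, Complex.ofReal_im,
    Complex.conj_re, Complex.conj_im]
  ring

lemma jointTrace_mul (hA : A.IsHermitian) (hB : B.IsHermitian) (f g : ℝ → ℝ) :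
    jointTrace hA hB (fun x y => f x * g y) = (cfc f A * cfc g B).trace.re := by
  simp only [jointTrace, eigenOverlap]
  rw [← trace_diagonal_mul_mul_diagonal_mul_conjTranspose_re, cfc_eq_mul_diagonal_mul hA,
    cfc_eq_mul_diagonal_mul hB, Matrix.conjTranspose_mul, Matrix.conjTranspose_conjTranspose]
  simp only [Matrix.mul_assoc]
  rw [Matrix.trace_mul_comm hA.eigenvectorUnitary.1]
  simp only [Matrix.mul_assoc]

lemma jointTrace_left (hA : A.IsHermitian) (hB : B.IsHermitian) (f : ℝ → ℝ) :
    jointTrace hA hB (fun x _ => f x) = (cfc f A).trace.re := by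
  have hone : cfc (fun _ : ℝ => (1 : ℝ)) B = 1 := cfc_const_one ℝ B hB
  simpa only [hone, mul_one] using jointTrace_mul hA hB f fun _ => 1

lemma jointTrace_right (hA : A.IsHermitian) (hB : B.IsHermitian) (g : ℝ → ℝ) :
    jointTrace hA hB (fun _ y => g y) = (cfc g B).trace.re := by
  have hone : cfc (fun _ : ℝ => (1 : ℝ)) A = 1 := cfc_const_one ℝ A hA
  simpa only [hone, one_mul] using jointTrace_mul hA hB (fun _ => 1) g

lemma jointTrace_sub_sq (hA : A.IsHermitian) (hB : B.IsHermitian) (f g : ℝ → ℝ) :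
    jointTrace hA hB (fun x y => (f x - g y) ^ 2) =
      ((cfc f A - cfc g B) * (cfc f A - cfc g B)).trace.re := by
  have hexpand : (fun x y => (f x - g y) ^ 2) =
      fun x y => f x * f x - 2 * (f x * g y) + g y * g y := by
    funext x y
    ring
  rw [hexpand, jointTrace_add, jointTrace_sub, jointTrace_const_mul, jointTrace_mul,
    jointTrace_left hA hB fun x => f x * f x, jointTrace_right hA hB fun y => g y * g y,
    ← cfc_mul_cfc, ← cfc_mul_cfc, sub_mul, mul_sub, mul_sub, Matrix.trace_sub, Matrix.trace_sub,
    Matrix.trace_sub, Matrix.trace_mul_comm (cfc g B) (cfc f A)]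
  simp only [Complex.sub_re]
  ring

lemma jointTrace_mono (hA : A.PosSemidef) (hB : B.PosSemidef) {F G : ℝ → ℝ → ℝ}
    (h : ∀ x y, 0 ≤ x → 0 ≤ y → F x y ≤ G x y) : jointTrace hA.1 hB.1 F ≤ jointTrace hA.1 hB.1 G :=
  Finset.sum_le_sum fun i _ => Finset.sum_le_sum fun j _ =>
    mul_le_mul_of_nonneg_left (h _ _ (hA.eigenvalues_nonneg i) (hB.eigenvalues_nonneg j))
      (eigenOverlap_nonneg _ _ i j)

lemma eigenOverlap_eq_zero_of_mul_supportProj (hA : A.PosSemidef) (hB : B.PosSemidef)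
    (h : A * supportProj B = A) {i j : ι} (hi : hA.1.eigenvalues i ≠ 0)
    (hj : hB.1.eigenvalues j = 0) : eigenOverlap hA.1 hB.1 i j = 0 := by
  set F : ℝ → ℝ → ℝ := fun x y => x - x * if y = 0 then 0 else 1
  have hF : ∀ x y, F x y = if y = 0 then x else 0 := fun x y => by
    simp only [F]
    split_ifs <;> ring
  have hnonneg : ∀ i j, 0 ≤ eigenOverlap hA.1 hB.1 i j *
      F (hA.1.eigenvalues i) (hB.1.eigenvalues j) := fun i j =>
    mul_nonneg (eigenOverlap_nonneg _ _ i j) <| by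
      rw [hF]
      split_ifs
      exacts [hA.eigenvalues_nonneg i, le_rfl]
  have hsum : jointTrace hA.1 hB.1 F = 0 := by
    rw [jointTrace_sub, jointTrace_left hA.1 hB.1 fun x => x,
      jointTrace_mul hA.1 hB.1 (fun x => x) fun y => if y = 0 then 0 else 1,
      cfc_id_of_isHermitian hA.1, ← supportProj, h, sub_self]
  have hrow := (Finset.sum_eq_zero_iff_of_nonneg fun i _ =>
    Finset.sum_nonneg fun j _ => hnonneg i j).1 hsum i (Finset.mem_univ i)
  have hterm := (Finset.sum_eq_zero_iff_of_nonneg fun j _ => hnonneg i j).1 hrow j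
    (Finset.mem_univ j)
  simpa [hF, hj, hi] using hterm

lemma jointTrace_mono_of_mul_supportProj (hA : A.PosSemidef) (hB : B.PosSemidef)
    (h : A * supportProj B = A) {F G : ℝ → ℝ → ℝ}
    (hFG : ∀ x y, 0 ≤ x → 0 ≤ y → (y = 0 → x = 0) → F x y ≤ G x y) :
    jointTrace hA.1 hB.1 F ≤ jointTrace hA.1 hB.1 G := by
  refine Finset.sum_le_sum fun i _ => Finset.sum_le_sum fun j _ => ?_
  by_cases hij : hB.1.eigenvalues j = 0 → hA.1.eigenvalues i = 0
  · have hle := hFG _ _ (hA.eigenvalues_nonneg i) (hB.eigenvalues_nonneg j) hij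
    exact mul_le_mul_of_nonneg_left hle (eigenOverlap_nonneg _ _ i j)
  · obtain ⟨hj, hi⟩ := Classical.not_imp.1 hij
    simp [eigenOverlap_eq_zero_of_mul_supportProj hA hB h hi hj]

theorem trace_add_mul_entropy_add_sq_sub_le_trace_mul_matPow_neg (hA : A.PosSemidef)
    (hB : B.PosSemidef) (h : A * supportProj B = A) {ε : ℝ} (hε : 0 ≤ ε) :
    A.trace.re + ε * (entropy A + A.trace.re - B.trace.re +
      ((matPow A (1 / 2) - matPow B (1 / 2)) * (matPow A (1 / 2) - matPow B (1 / 2))).trace.re) ≤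
        (A * matPow B (-ε)).trace.re := by
  have hmono := jointTrace_mono_of_mul_supportProj hA hB h fun _ _ hx hy hxy =>
    add_mul_le_mul_rpow_neg hx hy hxy hε
  rw [jointTrace_add, jointTrace_const_mul, jointTrace_add, jointTrace_sub, jointTrace_add,
    jointTrace_sub_sq, jointTrace_mul hA.1 hB.1 (fun x => x) fun y => y ^ (-ε),
    jointTrace_left hA.1 hB.1 fun x => x, jointTrace_left, jointTrace_right hA.1 hB.1 fun y => y,
    cfc_id_of_isHermitian hA.1, cfc_id_of_isHermitian hB.1] at hmono
  simpa only [entropy, matPow, ← Real.sqrt_eq_rpow] using hmono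

theorem trace_mul_le_trace_matPow_add_trace_matPow (hA : A.PosSemidef) (hB : B.PosSemidef)
    {p q : ℝ} (hpq : p.HolderConjugate q) :
    (A * B).trace.re ≤ (matPow A p).trace.re / p + (matPow B q).trace.re / q := by
  have hmono := jointTrace_mono hA hB fun _ _ hx hy => Real.young_inequality_of_nonneg hx hy hpq
  simp only [div_eq_inv_mul] at hmono ⊢
  rwa [jointTrace_add, jointTrace_const_mul, jointTrace_const_mul,
    jointTrace_mul hA.1 hB.1 (fun x => x) fun y => y,
    jointTrace_left hA.1 hB.1 fun x => x ^ p, jointTrace_right hA.1 hB.1 fun y => y ^ q,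
    cfc_id_of_isHermitian hA.1, cfc_id_of_isHermitian hB.1] at hmono

end JointTrace

section SchattenNorm

variable {ι : Type*} [Fintype ι] [DecidableEq ι] {A : Matrix ι ι ℂ}

lemma schattenNorm_nonneg (p : ℝ) (A : Matrix ι ι ℂ) : 0 ≤ schattenNorm p A :=
  Real.rpow_nonneg (trace_matPow_re_nonneg (Matrix.posSemidef_conjTranspose_mul_self A) _) _

lemma schattenNorm_of_posSemidef (hA : A.PosSemidef) (p : ℝ) :
    schattenNorm p A = (matPow A p).trace.re ^ (1 / p) := by
  have hsq : Aᴴ * A = matPow A 2 := by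
    rw [hA.1, ← one_add_one_eq_two, ← matPow_mul_matPow hA (by norm_num), matPow_one hA.1]
  rw [schattenNorm, hsq, matPow_matPow hA, mul_div_cancel₀ _ two_ne_zero]

lemma schattenNorm_conjTranspose_mul_self (p : ℝ) (A : Matrix ι ι ℂ) :
    schattenNorm p (Aᴴ * A) = schattenNorm p (A * Aᴴ) := by
  have hl := Matrix.posSemidef_conjTranspose_mul_self A
  have hr := Matrix.posSemidef_self_mul_conjTranspose A
  rw [schattenNorm_of_posSemidef hl, schattenNorm_of_posSemidef hr, matPow, matPow,
    trace_cfc_eq_of_charpoly_eq hl.1 hr.1 (Matrix.charpoly_mul_comm _ _)]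

lemma schattenNorm_matPow_of_isDensity (hA : IsDensity A) {r s : ℝ} (h : s * r = 1) :
    schattenNorm r (matPow A s) = 1 := by
  rw [schattenNorm_of_posSemidef (posSemidef_matPow hA.1 s), matPow_matPow hA.1, h,
    matPow_one hA.1.1, hA.2, Complex.one_re, Real.one_rpow]

lemma schattenNorm_le_schattenNorm_iff {B : Matrix ι ι ℂ} (hA : A.PosSemidef) (hB : B.PosSemidef)
    {p : ℝ} (hp : 0 < p) :
    schattenNorm p A ≤ schattenNorm p B ↔ (matPow A p).trace.re ≤ (matPow B p).trace.re := by
  rw [schattenNorm_of_posSemidef hA, schattenNorm_of_posSemidef hB]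
  exact Real.rpow_le_rpow_iff (trace_matPow_re_nonneg hA p) (trace_matPow_re_nonneg hB p)
    (by positivity)

end SchattenNorm

section PartialTrace

variable {m n : ℕ} {X : Matrix (Fin m × Fin n) (Fin m × Fin n) ℂ} {B C : Matrix (Fin m) (Fin m) ℂ}

lemma ampl_mul (A B : Matrix (Fin m) (Fin m) ℂ) : ampl n (A * B) = ampl n A * ampl n B := by
  rw [ampl, ampl, ampl, ← Matrix.mul_kronecker_mul, one_mul]

lemma ampl_sub (A B : Matrix (Fin m) (Fin m) ℂ) : ampl n (A - B) = ampl n A - ampl n B := by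
  ext i j
  simp [ampl, sub_mul]

lemma ampl_one : ampl n (1 : Matrix (Fin m) (Fin m) ℂ) = 1 :=
  Matrix.one_kronecker_one

lemma conjTranspose_ampl (A : Matrix (Fin m) (Fin m) ℂ) : (ampl n A)ᴴ = ampl n Aᴴ := by
  rw [ampl, ampl, Matrix.conjTranspose_kronecker, Matrix.conjTranspose_one]

lemma posSemidef_ampl {A : Matrix (Fin m) (Fin m) ℂ} (hA : A.PosSemidef) :
    (ampl n A).PosSemidef :=
  hA.kronecker Matrix.PosSemidef.one

lemma continuous_ampl : Continuous (ampl n : Matrix (Fin m) (Fin m) ℂ → _) :=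
  continuous_matrix fun _ _ => (continuous_id.matrix_elem _ _).mul continuous_const

lemma continuous_partialTrace₂ :
    Continuous (partialTrace₂ : Matrix (Fin m × Fin n) (Fin m × Fin n) ℂ → _) := by
  refine continuous_matrix fun i j => ?_
  simp only [partialTrace₂, Matrix.of_apply]
  exact continuous_finsetSum _ fun k _ => continuous_id.matrix_elem _ _

lemma partialTrace₂_mul_ampl (X : Matrix (Fin m × Fin n) (Fin m × Fin n) ℂ)
    (C : Matrix (Fin m) (Fin m) ℂ) : partialTrace₂ (X * ampl n C) = partialTrace₂ X * C := by
  ext i j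
  simp only [partialTrace₂, ampl, Matrix.of_apply, Matrix.mul_apply, Matrix.kronecker_apply,
    Fintype.sum_prod_type, Matrix.one_apply, mul_ite, mul_one, mul_zero, Finset.sum_ite_eq',
    Finset.mem_univ, if_true, Finset.sum_mul]
  exact Finset.sum_comm

lemma trace_partialTrace₂ (X : Matrix (Fin m × Fin n) (Fin m × Fin n) ℂ) :
    (partialTrace₂ X).trace = X.trace := by
  simp only [Matrix.trace, Matrix.diag_apply, partialTrace₂, Matrix.of_apply, Fintype.sum_prod_type]

lemma trace_mul_ampl (X : Matrix (Fin m × Fin n) (Fin m × Fin n) ℂ)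
    (C : Matrix (Fin m) (Fin m) ℂ) : (X * ampl n C).trace = (partialTrace₂ X * C).trace := by
  rw [← trace_partialTrace₂, partialTrace₂_mul_ampl]

lemma posSemidef_partialTrace₂ (hX : X.PosSemidef) : (partialTrace₂ X).PosSemidef := by
  have hsum : partialTrace₂ X = ∑ k : Fin n, X.submatrix (fun i => (i, k)) (fun i => (i, k)) := by
    ext i j
    simp [partialTrace₂, Matrix.sum_apply]
  rw [hsum]
  exact Matrix.posSemidef_sum _ fun k _ => hX.submatrix _

lemma isDensity_partialTrace₂ (hX : IsDensity X) : IsDensity (partialTrace₂ X) :=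
  ⟨posSemidef_partialTrace₂ hX.1, (trace_partialTrace₂ X).trans hX.2⟩

lemma matPow_mul_ampl_eq_zero (hX : X.PosSemidef) (hC : partialTrace₂ X * C = 0) {s : ℝ}
    (hs : s ≠ 0) : matPow X s * ampl n C = 0 := by
  have hhalf : matPow X (1 / 2) * ampl n C = 0 := by
    rw [← Matrix.trace_conjTranspose_mul_self_eq_zero_iff, Matrix.conjTranspose_mul,
      (isHermitian_matPow X _).eq, Matrix.mul_assoc, ← Matrix.mul_assoc (matPow X _),
      matPow_half_mul_self hX, Matrix.trace_mul_comm, conjTranspose_ampl, Matrix.mul_assoc,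
      ← ampl_mul, trace_mul_ampl, ← Matrix.mul_assoc, hC, Matrix.zero_mul, Matrix.trace_zero]
  have hsplit : matPow X s = matPow X (s - 1 / 2) * matPow X (1 / 2) := by
    rw [matPow_mul_matPow hX (by rwa [sub_add_cancel]), sub_add_cancel]
  rw [hsplit, Matrix.mul_assoc, hhalf, mul_zero]

lemma matPow_mul_ampl_supportProj (hX : X.PosSemidef)
    (hB : partialTrace₂ X * supportProj B = partialTrace₂ X) {s : ℝ} (hs : s ≠ 0) :
    matPow X s * ampl n (supportProj B) = matPow X s := by
  have hzero : partialTrace₂ X * (1 - supportProj B) = 0 := by rw [mul_sub, mul_one, hB, sub_self]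
  have hmul := matPow_mul_ampl_eq_zero hX hzero hs
  rwa [ampl_sub, ampl_one, mul_sub, mul_one, sub_eq_zero, eq_comm] at hmul

lemma partialTrace₂_matPow_mul_supportProj (hX : X.PosSemidef)
    (hB : partialTrace₂ X * supportProj B = partialTrace₂ X) {s : ℝ} (hs : s ≠ 0) :
    partialTrace₂ (matPow X s) * supportProj B = partialTrace₂ (matPow X s) := by
  rw [← partialTrace₂_mul_ampl, matPow_mul_ampl_supportProj hX hB hs]

lemma partialTrace₂_mul_supportProj_of_mem_admissible (hB : B ∈ admissible X) :
    partialTrace₂ X * supportProj B = partialTrace₂ X :=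
  mul_supportProj_of_ker_le hB.1.1.1 hB.2

lemma partialTrace₂_mem_admissible (hX : IsDensity X) : partialTrace₂ X ∈ admissible X :=
  ⟨isDensity_partialTrace₂ hX, le_rfl⟩

end PartialTrace

section MixedNormBound

variable {m n : ℕ} {X : Matrix (Fin m × Fin n) (Fin m × Fin n) ℂ} {B : Matrix (Fin m) (Fin m) ℂ}
  {p : ℝ}

lemma norm1p_le_of_factorization {A C : Matrix (Fin m) (Fin m) ℂ}
    {Z : Matrix (Fin m × Fin n) (Fin m × Fin n) ℂ} (h : X = ampl n A * Z * ampl n C) :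
    norm1p p X ≤ schattenNorm (2 * (p / (p - 1))) A * schattenNorm (2 * (p / (p - 1))) C *
      schattenNorm p Z := by
  refine csInf_le ⟨0, ?_⟩ ⟨A, C, Z, h, rfl⟩
  rintro _ ⟨A, C, Z, -, rfl⟩
  exact mul_nonneg (mul_nonneg (schattenNorm_nonneg _ _) (schattenNorm_nonneg _ _))
    (schattenNorm_nonneg _ _)

lemma posSemidef_vMat (X : Matrix (Fin m × Fin n) (Fin m × Fin n) ℂ) (p : ℝ)
    (hB : B.PosSemidef) : (vMat X p B).PosSemidef := by
  simpa only [vMat, (isHermitian_matPow X _).eq] using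
    (posSemidef_ampl (posSemidef_matPow hB (1 / p - 1))).mul_mul_conjTranspose_same
      (matPow X (1 / 2))

lemma vMat_eq_mul_conjTranspose (X : Matrix (Fin m × Fin n) (Fin m × Fin n) ℂ)
    (hB : B.PosSemidef) (hp : 1 / p - 1 ≠ 0) :
    vMat X p B = (matPow X (1 / 2) * ampl n (matPow B ((1 / p - 1) / 2))) *
      (matPow X (1 / 2) * ampl n (matPow B ((1 / p - 1) / 2)))ᴴ := by
  rw [Matrix.conjTranspose_mul, conjTranspose_ampl, (isHermitian_matPow B _).eq,
    (isHermitian_matPow X _).eq, Matrix.mul_assoc, ← Matrix.mul_assoc (ampl n _), ← ampl_mul,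
    matPow_mul_matPow hB (by rwa [add_halves]), add_halves, ← Matrix.mul_assoc, vMat]

theorem norm1p_le_schattenNorm_vMat (hX : X.PosSemidef) (hB : B ∈ admissible X) (hp : 1 < p) :
    norm1p p X ≤ schattenNorm p (vMat X p B) := by
  set s := (1 / p - 1) / 2 with hs
  have hs₀ : s < 0 := by linarith [one_sub_one_div_pos hp]
  have hexp : -s * (2 * (p / (p - 1))) = 1 := by
    have hp₁ : p - 1 ≠ 0 := by linarith
    rw [hs]
    field_simp
    ring
  have hnorm := schattenNorm_matPow_of_isDensity hB.1 hexp
  set G := matPow X (1 / 2) * ampl n (matPow B s) with hG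
  have hright : G * ampl n (matPow B (-s)) = matPow X (1 / 2) := by
    rw [hG, Matrix.mul_assoc, ← ampl_mul, matPow_mul_matPow_neg hB.1.1 hs₀.ne,
      matPow_mul_ampl_supportProj hX (partialTrace₂_mul_supportProj_of_mem_admissible hB)
        one_half_pos.ne']
  have hleft : ampl n (matPow B (-s)) * Gᴴ = matPow X (1 / 2) := by
    rw [← (isHermitian_matPow B (-s)).eq, ← conjTranspose_ampl, ← Matrix.conjTranspose_mul, hright,
      (isHermitian_matPow X _).eq]
  have hfactor : X = ampl n (matPow B (-s)) * (Gᴴ * G) * ampl n (matPow B (-s)) := by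
    rw [← Matrix.mul_assoc, hleft, Matrix.mul_assoc, hright, matPow_half_mul_self hX]
  calc norm1p p X ≤ _ := norm1p_le_of_factorization hfactor
    _ = schattenNorm p (vMat X p B) := by
      rw [hnorm, one_mul, one_mul, schattenNorm_conjTranspose_mul_self,
        vMat_eq_mul_conjTranspose X hB.1.1 (by linarith)]

end MixedNormBound

section Convergence

variable {m n : ℕ} {X : Matrix (Fin m × Fin n) (Fin m × Fin n) ℂ} {B : Matrix (Fin m) (Fin m) ℂ}
  {p : ℝ}

/-- The marginal of `X ^ (2 - 1/p)`. It tends to the marginal of `X` as `p → 1`, and Young's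
inequality against `X ^ (1 - 1/p)` compares `B` with it rather than with the marginal of `X`. -/
noncomputable def tiltedMarginal (X : Matrix (Fin m × Fin n) (Fin m × Fin n) ℂ) (p : ℝ) :
    Matrix (Fin m) (Fin m) ℂ :=
  partialTrace₂ (matPow X (2 - 1 / p))

lemma posSemidef_tiltedMarginal (hX : X.PosSemidef) (p : ℝ) : (tiltedMarginal X p).PosSemidef :=
  posSemidef_partialTrace₂ (posSemidef_matPow hX _)

lemma tendsto_tiltedMarginal (hX : X.PosSemidef) :
    Tendsto (tiltedMarginal X) (𝓝[>] 1) (𝓝 (partialTrace₂ X)) := by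
  have hexp : Tendsto (fun p : ℝ => 2 - 1 / p) (𝓝[>] 1) (𝓝 1) := by
    convert tendsto_one_div_nhdsGT_one.const_sub 2 using 2
    norm_num
  have hpow := (tendsto_matPow X one_ne_zero).comp hexp
  rw [matPow_one hX.1] at hpow
  exact (continuous_partialTrace₂.tendsto X).comp hpow

lemma tendsto_vMat (hX : X.PosSemidef) (hB : partialTrace₂ X * supportProj B = partialTrace₂ X) :
    Tendsto (fun p => vMat X p B) (𝓝[>] 1) (𝓝 X) := by
  have hexp : Tendsto (fun p : ℝ => 1 / p - 1) (𝓝[>] 1) (𝓝[≠] 0) := by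
    refine tendsto_nhdsWithin_iff.2 ⟨?_, ?_⟩
    · simpa using tendsto_one_div_nhdsGT_one.sub_const 1
    · filter_upwards [self_mem_nhdsWithin] with p hp
      exact (by linarith [one_sub_one_div_pos hp] : 1 / p - 1 < 0).ne
  have hampl := (continuous_ampl (n := n).tendsto _).comp
    ((tendsto_matPow_supportProj B).comp hexp)
  have hlim := (hampl.const_mul (matPow X (1 / 2))).mul_const (matPow X (1 / 2))
  rwa [matPow_mul_ampl_supportProj hX hB one_half_pos.ne', matPow_half_mul_self hX] at hlim

lemma trace_vMat_mul_matPow (hX : X.PosSemidef) (p : ℝ) (B : Matrix (Fin m) (Fin m) ℂ) {s : ℝ}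
    (hs : 0 ≤ s) : (vMat X p B * matPow X s).trace =
      (partialTrace₂ (matPow X (1 + s)) * matPow B (1 / p - 1)).trace := by
  have hexp : 1 / 2 + s + 1 / 2 = 1 + s := by ring
  rw [← trace_mul_ampl, vMat, Matrix.mul_assoc, Matrix.mul_assoc, Matrix.trace_mul_comm,
    Matrix.mul_assoc, Matrix.trace_mul_comm, matPow_mul_matPow hX (by linarith),
    matPow_mul_matPow hX (by linarith), hexp]

lemma trace_vMat_partialTrace₂ (hX : X.PosSemidef) (hp : 0 < p) :
    (vMat X p (partialTrace₂ X)).trace = (matPow (partialTrace₂ X) (1 / p)).trace := by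
  have hS := posSemidef_partialTrace₂ hX
  have hexp : 1 + (1 / p - 1) ≠ 0 := by
    rw [add_sub_cancel]
    positivity
  rw [vMat, Matrix.trace_mul_cycle, matPow_half_mul_self hX, trace_mul_ampl]
  nth_rewrite 1 [← matPow_one hS.1]
  rw [matPow_mul_matPow hS hexp, add_sub_cancel]

lemma trace_tiltedMarginal_mul_matPow_le (hX : IsDensity X) (hB : B.PosSemidef) (hp : 1 < p) :
    (tiltedMarginal X p * matPow B (1 / p - 1)).trace.re ≤
      (matPow (vMat X p B) p).trace.re / p + (1 - 1 / p) := by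
  have hε : 0 < 1 - 1 / p := one_sub_one_div_pos hp
  have hpq : p.HolderConjugate (1 - 1 / p)⁻¹ := Real.holderConjugate_iff.2 ⟨hp, by simp⟩
  have hyoung := trace_mul_le_trace_matPow_add_trace_matPow (posSemidef_vMat X p hB)
    (posSemidef_matPow hX.1 (1 - 1 / p)) hpq
  have hexp : 1 + (1 - 1 / p) = 2 - 1 / p := by ring
  rwa [trace_vMat_mul_matPow hX.1 p B hε.le, matPow_matPow hX.1, mul_inv_cancel₀ hε.ne',
    matPow_one hX.1.1, hX.2, Complex.one_re, one_div (_ : ℝ)⁻¹, inv_inv, hexp] at hyoung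

theorem trace_sq_sqrt_tiltedMarginal_sub_le (hX : IsDensity X) (hB : B ∈ admissible X)
    (hp : 1 < p) :
    ((matPow (tiltedMarginal X p) (1 / 2) - matPow B (1 / 2)) *
        (matPow (tiltedMarginal X p) (1 / 2) - matPow B (1 / 2))).trace.re ≤
      ((matPow (vMat X p B) p).trace.re - 1) / (p - 1) +
        (entropy X - entropy (tiltedMarginal X p) + 1 - (tiltedMarginal X p).trace.re) := by
  set Y := tiltedMarginal X p with hY
  set D := ((matPow Y (1 / 2) - matPow B (1 / 2)) *
    (matPow Y (1 / 2) - matPow B (1 / 2))).trace.re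
  set T := (matPow (vMat X p B) p).trace.re
  have hp₁ : 0 < p - 1 := sub_pos.2 hp
  have hε : 0 < 1 - 1 / p := one_sub_one_div_pos hp
  have hexp : 2 - 1 / p = 1 + (1 - 1 / p) := by ring
  have hsupport : Y * supportProj B = Y :=
    partialTrace₂_matPow_mul_supportProj hX.1
      (partialTrace₂_mul_supportProj_of_mem_admissible hB) (by linarith)
  have hgibbs : Y.trace.re + (1 - 1 / p) * (entropy Y + Y.trace.re - 1 + D) ≤
      (Y * matPow B (1 / p - 1)).trace.re := by
    simpa only [hB.1.2, Complex.one_re, neg_sub] using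
      trace_add_mul_entropy_add_sq_sub_le_trace_mul_matPow_neg
        (posSemidef_tiltedMarginal hX.1 p) hB.1.1 hsupport hε.le
  have hyoung : (Y * matPow B (1 / p - 1)).trace.re ≤ T / p + (1 - 1 / p) :=
    trace_tiltedMarginal_mul_matPow_le hX hB.1.1 hp
  have hentropy : 1 - (1 - 1 / p) * entropy X ≤ Y.trace.re := by
    rw [hY, tiltedMarginal, trace_partialTrace₂, hexp]
    simpa only [hX.2, Complex.one_re] using trace_sub_mul_entropy_le_trace_matPow hX.1 hε.le
  have hquot : (1 - 1 / p) * ((T - 1) / (p - 1)) = T / p + (1 - 1 / p) - 1 := by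
    field_simp
    ring
  refine le_of_mul_le_mul_left ?_ hε
  linarith

theorem eventually_trace_matPow_vMat_partialTrace₂_sub_one_div_lt (hX : IsDensity X) {c : ℝ}
    (hc : entropy (partialTrace₂ X) - entropy X < c) :
    ∀ᶠ p in 𝓝[>] 1, ((matPow (vMat X p (partialTrace₂ X)) p).trace.re - 1) / (p - 1) < c := by
  set S := partialTrace₂ X
  have hS : IsDensity S := isDensity_partialTrace₂ hX
  have hX_trace : (matPow X 1).trace.re = 1 := by rw [matPow_one hX.1.1, hX.2, Complex.one_re]
  have hS_trace : (matPow S (1 / 1)).trace.re = 1 := by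
    rw [div_one, matPow_one hS.1.1, hS.2, Complex.one_re]
  have hlimX : Tendsto (fun q => ((matPow X q).trace.re - 1) / (q - 1)) (𝓝[>] 1)
      (𝓝 (-entropy X)) := by
    simpa only [hX_trace] using
      tendsto_slope_nhdsGT_of_hasDerivAt (hasDerivAt_trace_matPow_one hX.1)
  have hlimS : Tendsto (fun p : ℝ => ((matPow S (1 / p)).trace.re - 1) / (p - 1)) (𝓝[>] 1)
      (𝓝 (entropy S)) := by
    simpa only [hS_trace] using
      tendsto_slope_nhdsGT_of_hasDerivAt (hasDerivAt_trace_matPow_one_div_one hS.1)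
  have hlt : -entropy X < c - entropy S := by linarith
  obtain ⟨q, hqc, hq⟩ := ((hlimX.eventually_lt_const hlt).and self_mem_nhdsWithin).exists
  replace hq : 1 < q := hq
  have hv := tendsto_vMat hX.1
    (partialTrace₂_mul_supportProj_of_mem_admissible (partialTrace₂_mem_admissible hX))
  have hvq : Tendsto (fun p => matPow (vMat X p S) q) (𝓝[>] 1) (𝓝 (matPow X q)) :=
    tendsto_cfc_of_tendsto (Real.continuous_rpow_const (by linarith))
      (Eventually.of_forall fun p => (posSemidef_vMat X p hS.1).1) hX.1.1 hv
  have hlim := (((tendsto_trace_re hvq).sub (tendsto_trace_re hv)).div_const (q - 1)).add hlimS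
  rw [hX.2, Complex.one_re] at hlim
  filter_upwards [hlim.eventually_lt_const (u := c) (by linarith), Ioc_mem_nhdsGT hq]
    with p hpc hpq
  -- Convexity of `q ↦ x ^ q` trades the moving exponent `p` for the fixed exponent `q`.
  have hmono := trace_matPow_sub_trace_div_le (posSemidef_vMat X p hS.1) hpq.1 hpq.2
  rw [trace_vMat_partialTrace₂ hX.1 (one_pos.trans hpq.1)] at hmono hpc
  rw [← sub_add_sub_cancel _ (matPow S (1 / p)).trace.re, add_div]
  linarith

theorem tendsto_sqrt_tiltedMarginal_sub {B : ℝ → Matrix (Fin m) (Fin m) ℂ} (hX : IsDensity X)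
    (hB : ∀ᶠ p in 𝓝[>] 1, B p ∈ admissible X ∧
      schattenNorm p (vMat X p (B p)) ≤ schattenNorm p (vMat X p (partialTrace₂ X))) :
    Tendsto (fun p => matPow (tiltedMarginal X p) (1 / 2) - matPow (B p) (1 / 2))
      (𝓝[>] 1) (𝓝 0) := by
  have hS := isDensity_partialTrace₂ hX
  have hY := tendsto_tiltedMarginal hX.1
  have hY_entropy := tendsto_entropy
    (Eventually.of_forall fun p => (posSemidef_tiltedMarginal hX.1 p).1) hS.1.1 hY
  have hrest := ((hY_entropy.const_sub (entropy X)).add_const 1).sub (tendsto_trace_re hY)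
  rw [hS.2, Complex.one_re, add_sub_cancel_right] at hrest
  refine tendsto_zero_of_tendsto_trace_conjTranspose_mul_self
    (tendsto_order.2 ⟨fun η hη => ?_, fun η hη => ?_⟩)
  · exact Eventually.of_forall fun p => hη.trans_le
      (Complex.le_def.1 (Matrix.posSemidef_conjTranspose_mul_self _).trace_nonneg).1
  · have hupper := eventually_trace_matPow_vMat_partialTrace₂_sub_one_div_lt hX
      (lt_add_of_pos_right _ (half_pos hη))
    have hrest_lt := hrest.eventually_lt_const (lt_add_of_pos_right _ (half_pos hη))
    filter_upwards [hB, hupper, hrest_lt, self_mem_nhdsWithin] with p hBp hup hre (hp : 1 < p)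
    have hle := (schattenNorm_le_schattenNorm_iff (posSemidef_vMat X p hBp.1.1.1)
      (posSemidef_vMat X p hS.1) (one_pos.trans hp)).1 hBp.2
    have hquot := div_le_div_of_nonneg_right (sub_le_sub_right hle 1) (sub_pos.2 hp).le
    rw [((isHermitian_matPow _ _).sub (isHermitian_matPow _ _)).eq]
    linarith [trace_sq_sqrt_tiltedMarginal_sub_le hX hBp.1 hp]

end Convergence

end MixedNorm

theorem mainTheorem10_general {m n : ℕ} (X : Matrix (Fin m × Fin n) (Fin m × Fin n) ℂ)
    (hX : MixedNorm.IsDensity X) (B : ℝ → Matrix (Fin m) (Fin m) ℂ)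
    (hB : ∀ᶠ p in 𝓝[>] 1, B p ∈ MixedNorm.admissible X ∧
      MixedNorm.schattenNorm p (MixedNorm.vMat X p (B p)) ≤
        MixedNorm.schattenNorm p (MixedNorm.vMat X p (MixedNorm.partialTrace₂ X))) :
    Tendsto B (𝓝[>] 1) (𝓝 (MixedNorm.partialTrace₂ X)) := by
  have hS := (MixedNorm.isDensity_partialTrace₂ hX).1
  have hsqrtY : Tendsto (fun p => MixedNorm.matPow (MixedNorm.tiltedMarginal X p) (1 / 2))
      (𝓝[>] 1) (𝓝 (MixedNorm.matPow (MixedNorm.partialTrace₂ X) (1 / 2))) :=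
    MixedNorm.tendsto_cfc_of_tendsto (Real.continuous_rpow_const one_half_pos.le)
      (Eventually.of_forall fun p => (MixedNorm.posSemidef_tiltedMarginal hX.1 p).1) hS.1
      (MixedNorm.tendsto_tiltedMarginal hX.1)
  have hsqrtB := hsqrtY.sub (MixedNorm.tendsto_sqrt_tiltedMarginal_sub hX hB)
  simp only [sub_sub_cancel, sub_zero] at hsqrtB
  have hsq := hsqrtB.mul hsqrtB
  rw [MixedNorm.matPow_half_mul_self hS] at hsq
  refine hsq.congr' ?_
  filter_upwards [hB] with p hBp using MixedNorm.matPow_half_mul_self hBp.1.1.1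

theorem mainTheorem10 {m n : ℕ} (X : Matrix (Fin m × Fin n) (Fin m × Fin n) ℂ)
    (hX : MixedNorm.IsDensity X) (B : ℝ → Matrix (Fin m) (Fin m) ℂ)
    (hB : ∀ p ∈ Set.Ioc (1 : ℝ) 2, MixedNorm.IsMinimizer X p (B p)) :
    Tendsto B (𝓝[>] (1 : ℝ)) (𝓝 (MixedNorm.partialTrace₂ X)) := by
  refine mainTheorem10_general X hX B ?_
  filter_upwards [Ioc_mem_nhdsGT one_lt_two] with p hp
  exact ⟨(hB p hp).1, (hB p hp).2.trans_le (MixedNorm.norm1p_le_schattenNorm_vMat hX.1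
    (MixedNorm.partialTrace₂_mem_admissible hX) hp.1)⟩
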